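/- Let $\Omega\subset\mathbb R^d$ be bounded, let $\tau>d/2$ and $\sigma\in(\tfrac{d}{2\tau},1]$. Let $k(x,z)=\Phi(x-z)$ and $k^{(\sigma)}(x,z)=\Phi^{(\sigma)}(x-z)$ be the translation invariant kernels on $\Omega$ given by the continuous integrable functions $\Phi,\Phi^{(\sigma)}:\mathbb R^d\to\mathbb R$ with Fourier transforms $$\hat\Phi(\omega)=(1+\|\omega\|^2)^{-\tau},\qquad \hat\Phi^{(\sigma)}(\omega)=(1+\|\omega\|^2)^{-\sigma\tau}\qquad(\omega\in\mathbb R^d),$$ where $\hat f(\omega)=(2\pi)^{-d/2}\int_{\mathbb R^d}f(x)e^{-i\omega^\top x}\,\mathrm dx$. For a positive definite kernel $\kappa$ on $\Omega$ (symmetric, with positive semidefinite kernel matrices) let $\mathcal H_\kappa(\Omega)$ be its reproducing kernel Hilbert space. Then there is a constant $c>0$, depending only on $d,\tau,\sigma$ and $\Omega$, such that the following holds. Let $\tilde k,\tilde k^{(\sigma)}:\Omega\times\Omega\to\mathbb R$ be positive definite kernels, not necessarily translation invariant, that are norm-equivalent to $k$ and $k^{(\sigma)}$, i.e. $\mathcal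 H_{\tilde k}(\Omega)=\mathcal H_k(\Omega)$ and $\mathcal H_{\tilde k^{(\sigma)}}(\Omega)=\mathcal H_{k^{(\sigma)}}(\Omega)$ as sets of functions and, for some constants $C,C_1>0$, $$C^{-1}\|\cdot\|_{\mathcal H_k(\Omega)}\le\|\cdot\|_{\mathcal H_{\tilde k}(\Omega)}\le C\|\cdot\|_{\mathcal H_k(\Omega)},\qquad C_1^{-1}\|\cdot\|_{\mathcal H_{k^{(\sigma)}}(\Omega)}\le\|\cdot\|_{\mathcal H_{\tilde k^{(\sigma)}}(\Omega)}\le C_1\|\cdot\|_{\mathcal H_{k^{(\sigma)}}(\Omega)}.$$ Let $X\subset\Omega$ be a finite set of at least two points, with separation distance $q_X=\min_{x\ne y\in X}\|x-y\|$, and let $\tilde A=(\tilde k(x,y))_{x,y\in X}$ and $\tilde A^{(\sigma)}=(\tilde k^{(\sigma)}(x,y))_{x,y\in X}$ be the kernel matrices. Then for all $0\ne\alpha\in\mathbb R^{|X|}$ $$C_1^{-2}C^{-2}\,\frac{\alpha^\top\tilde A\alpha}{\|\alpha\|^2}\;\le\;\frac{\alpha^\top\tilde A^{(\sigma)}\alpha}{\|\alpha\|^2}\;\le\;C_1^{2}C^{2}\,c\,q_X^{-(1-\sigma)2\tau}\,\frac{\alpha^\top\tilde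 A\alpha}{\|\alpha\|^2}.$$ -/

import Mathlib

open MeasureTheory
open scoped Matrix

/-! ### Kernels and their reproducing kernel Hilbert spaces -/

/-- `k : S × S → ℝ` is a positive definite kernel: it is symmetric and all of its kernel matrices
are positive semidefinite. -/
def IsPosDefKernel {S : Type*} (k : S → S → ℝ) : Prop :=
  (∀ x y, k x y = k y x) ∧
    ∀ c : S →₀ ℝ, 0 ≤ c.sum fun x a => c.sum fun y b => a * b * k x y

/-- A real-valued kernel regarded as an operator-valued kernel on the one-dimensional space `ℝ`. -/
noncomputable def opKernel {S : Type*} (k : S → S → ℝ) : Matrix S S (ℝ →L[ℝ] ℝ) :=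
  Matrix.of fun x y => k x y • ContinuousLinearMap.id ℝ ℝ

theorem IsPosDefKernel.posSemidef {S : Type*} {k : S → S → ℝ} (hk : IsPosDefKernel k) :
    (opKernel k).PosSemidef := by
  have iff02 := (RKHS.posSemidef_tfae (K := opKernel k)).out 0 2
  refine iff02.mpr ⟨?_, ?_⟩
  · ext x y
    simp [opKernel, Matrix.conjTranspose_apply, hk.1 x y, ContinuousLinearMap.star_eq_adjoint,
      ContinuousLinearMap.adjoint_id]
  · intro c
    have h := hk.2 c
    have e : (c.sum fun x a => c.sum fun y b => inner ℝ (opKernel k y x a) b)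
        = c.sum fun x a => c.sum fun y b => a * b * k x y := by
      refine Finsupp.sum_congr fun x _ => Finsupp.sum_congr fun y _ => ?_
      simp only [opKernel, Matrix.of_apply, smul_apply,
        ContinuousLinearMap.id_apply, smul_eq_mul, RCLike.inner_apply, conj_trivial]
      rw [hk.1 y x]
      ring
    rw [e]
    exact h

/-- The reproducing kernel Hilbert space `H_k(S)` of the positive definite kernel `k`. -/
def KernelSpace {S : Type*} (k : S → S → ℝ) (hk : IsPosDefKernel k) : Type _ :=
  haveI : Fact (opKernel k).PosSemidef := ⟨hk.posSemidef⟩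
  RKHS.OfKernel (opKernel k)

noncomputable instance {S : Type*} (k : S → S → ℝ) (hk : IsPosDefKernel k) :
    NormedAddCommGroup (KernelSpace k hk) :=
  haveI : Fact (opKernel k).PosSemidef := ⟨hk.posSemidef⟩
  inferInstanceAs (NormedAddCommGroup (RKHS.OfKernel (opKernel k)))

noncomputable instance {S : Type*} (k : S → S → ℝ) (hk : IsPosDefKernel k) :
    InnerProductSpace ℝ (KernelSpace k hk) :=
  haveI : Fact (opKernel k).PosSemidef := ⟨hk.posSemidef⟩
  inferInstanceAs (InnerProductSpace ℝ (RKHS.OfKernel (opKernel k)))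

instance {S : Type*} (k : S → S → ℝ) (hk : IsPosDefKernel k) :
    CompleteSpace (KernelSpace k hk) :=
  haveI : Fact (opKernel k).PosSemidef := ⟨hk.posSemidef⟩
  inferInstanceAs (CompleteSpace (RKHS.OfKernel (opKernel k)))

noncomputable instance {S : Type*} (k : S → S → ℝ) (hk : IsPosDefKernel k) :
    RKHS ℝ (KernelSpace k hk) S ℝ :=
  haveI : Fact (opKernel k).PosSemidef := ⟨hk.posSemidef⟩
  inferInstanceAs (RKHS ℝ (RKHS.OfKernel (opKernel k)) S ℝ)

/-- The reproducing kernel of `H_k(S)` is `k`. -/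
theorem KernelSpace.kernel_apply {S : Type*} (k : S → S → ℝ) (hk : IsPosDefKernel k) (x y : S) :
    RKHS.kernel (KernelSpace k hk) x y (1 : ℝ) = k x y := by
  have : Fact (opKernel k).PosSemidef := ⟨hk.posSemidef⟩
  have h : RKHS.kernel (KernelSpace k hk) = opKernel k :=
    RKHS.OfKernel.kernel_ofKernel (K := opKernel k)
  rw [h]
  simp [opKernel]

/-- The kernels `k₁` and `k₂` on `S` are norm-equivalent with constant `C > 0`: their reproducing
kernel Hilbert spaces consist of the same functions on `S`, and
`C⁻¹ * ‖f‖_{k₁} ≤ ‖f‖_{k₂} ≤ C * ‖f‖_{k₁}` for each of these functions `f`. -/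
def NormEquivalentKernels {S : Type*} (k₁ k₂ : S → S → ℝ) (C : ℝ) : Prop :=
  0 < C ∧ ∃ (h₁ : IsPosDefKernel k₁) (h₂ : IsPosDefKernel k₂),
    (Set.range fun f : KernelSpace k₁ h₁ => (f : S → ℝ)) =
        (Set.range fun f : KernelSpace k₂ h₂ => (f : S → ℝ)) ∧
      ∀ (f₁ : KernelSpace k₁ h₁) (f₂ : KernelSpace k₂ h₂), (f₁ : S → ℝ) = (f₂ : S → ℝ) →
        C⁻¹ * ‖f₁‖ ≤ ‖f₂‖ ∧ ‖f₂‖ ≤ C * ‖f₁‖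

/-! ### Translational invariant kernels of finite smoothness -/

/-- The Fourier transform
`Φ̂(ω) = (2π)^(-d/2) ∫ Φ(x) e^{-i ω ⬝ x} dx` of a real function on `ℝ^d`. -/
noncomputable def unitaryFourier {d : ℕ} (Φ : EuclideanSpace ℝ (Fin d) → ℝ)
    (ω : EuclideanSpace ℝ (Fin d)) : ℂ :=
  (((2 * Real.pi) ^ (-(d : ℝ) / 2) : ℝ) : ℂ) *
    ∫ x, (Φ x : ℂ) * Complex.exp (-(Complex.I * ((inner ℝ ω x : ℝ) : ℂ)))

/-- `Φ` is continuous, integrable and has the Fourier transform `(1 + ‖ω‖²)^(-s)`. -/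
structure HasSobolevDecay {d : ℕ} (Φ : EuclideanSpace ℝ (Fin d) → ℝ) (s : ℝ) : Prop where
  continuous : Continuous Φ
  integrable : Integrable Φ
  fourier_eq : ∀ ω, unitaryFourier Φ ω = (((1 + ‖ω‖ ^ 2) ^ (-s) : ℝ) : ℂ)

/-- The translational invariant kernel `k(x, z) = Φ(x - z)` on `Ω ⊆ ℝ^d`. -/
def translationKernel {d : ℕ} (Ω : Set (EuclideanSpace ℝ (Fin d)))
    (Φ : EuclideanSpace ℝ (Fin d) → ℝ) : Ω → Ω → ℝ :=
  fun x z => Φ ((x : EuclideanSpace ℝ (Fin d)) - (z : EuclideanSpace ℝ (Fin d)))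

/-! ### Kernel matrices -/

/-- The kernel matrix `k(X, X)`. -/
def kernelMatrix {S : Type*} (k : S → S → ℝ) (X : Finset S) : Matrix X X ℝ :=
  Matrix.of fun x y => k x y

/-- The Rayleigh quotient `αᵀ A α / ‖α‖²`, with the Euclidean norm of `α`. -/
noncomputable def rayleigh {ι : Type*} [Fintype ι] (A : Matrix ι ι ℝ)
    (α : EuclideanSpace ℝ ι) : ℝ :=
  (α.ofLp ⬝ᵥ (A *ᵥ α.ofLp)) / ‖α‖ ^ 2

/-- The separation distance `q_X`, the least distance between two distinct points of `X`
(for sets with at least two points). -/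
noncomputable def separationDist {S : Type*} [PseudoMetricSpace S] (X : Finset S) : ℝ :=
  (X : Set S).infsep

/-! By the reproducing property, `αᵀ k(X,X) α` is the squared norm of the representer of `f ↦ ∑ α x
* f x`. Norm equivalence therefore changes each form by at most the square of its constant
(`NormEquivalentKernels.kernelForm_le`), and only the two translation invariant kernels remain to be
compared.

Write `J_s` for `besselWeight s`, with `s = σ * τ`. By Fourier inversion their forms are, up to a
common factor, integrals of `J_τ` and `J_s` against `|∑ α x e^{2πi⟨v,x⟩}|² ≥ 0`, so pointwise
inequalities between weights pass to forms. Since `J_τ ≤ J_s`, the lower bound follows.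

For `s < τ` no bound `J_s ≤ M J_τ` holds at high frequencies. It suffices that `J_s(v) ≤ M J_τ(v) +
l ψ(q v)`, where the cosine transform of `ψ` vanishes at the origin and outside the unit ball: for
points at mutual distance at least `q`, the term `ψ(q ·)` contributes nothing to the form. Such a
`ψ` is `g ⋆ J_s - κ g` with `g ≥ 0` bandlimited (`exists_annihilated_minorant`), and scaling gives
`M = c q^(-2(τ - s))`. -/

/-! ### Quadratic forms of kernels -/

/-- The quadratic form `αᵀ k(X, X) α` of a kernel. -/
noncomputable def kernelForm {S : Type*} (k : S → S → ℝ) (X : Finset S) (α : X → ℝ) : ℝ :=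
  ∑ x : X, ∑ y : X, α x * α y * k x y

theorem rayleigh_kernelMatrix {S : Type*} (k : S → S → ℝ) (X : Finset S)
    (α : EuclideanSpace ℝ X) :
    rayleigh (kernelMatrix k X) α = kernelForm k X α / ‖α‖ ^ 2 := by
  unfold rayleigh kernelForm
  congr 1
  simp only [dotProduct, Matrix.mulVec, kernelMatrix, Matrix.of_apply, Finset.mul_sum]
  refine Finset.sum_congr rfl fun x _ => Finset.sum_congr rfl fun y _ => ?_
  ring

/-- The function `∑ x, α x • k(x, ·)` as an element of the reproducing kernel Hilbert space. -/
noncomputable def kernelCombination {S : Type*} (k : S → S → ℝ) (hk : IsPosDefKernel k)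
    (X : Finset S) (α : X → ℝ) : KernelSpace k hk :=
  ∑ x : X, α x • RKHS.kerFun (KernelSpace k hk) (x : S) (1 : ℝ)

theorem inner_kernelCombination {S : Type*} (k : S → S → ℝ) (hk : IsPosDefKernel k)
    (X : Finset S) (α : X → ℝ) (f : KernelSpace k hk) :
    inner ℝ (kernelCombination k hk X α) f = ∑ x : X, α x * f (x : S) := by
  simp [kernelCombination, sum_inner, inner_smul_left]

theorem kernelForm_eq_norm_sq {S : Type*} (k : S → S → ℝ) (hk : IsPosDefKernel k)
    (X : Finset S) (α : X → ℝ) :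
    kernelForm k X α = ‖kernelCombination k hk X α‖ ^ 2 := by
  rw [← real_inner_self_eq_norm_sq]
  conv_rhs => rw [kernelCombination]
  simp only [kernelForm, sum_inner, inner_smul_left, inner_sum,
    inner_smul_right, ← RKHS.kernel_inner, KernelSpace.kernel_apply, Finset.mul_sum]
  refine Finset.sum_congr rfl fun x _ => Finset.sum_congr rfl fun y _ => ?_
  simp [hk.1 x y]
  ring

/-- Duality: both combinations represent the same functional `f ↦ ∑ α x * f x`, each in its own
space. Evaluating it at the second representer, viewed as an element of the first space, and
applying Cauchy-Schwarz bounds one norm by the other. -/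
theorem norm_kernelCombination_le {S : Type*} {k₁ k₂ : S → S → ℝ} (h₁ : IsPosDefKernel k₁)
    (h₂ : IsPosDefKernel k₂) {C : ℝ} (hC : 0 ≤ C)
    (h : ∀ f₂ : KernelSpace k₂ h₂, ∃ f₁ : KernelSpace k₁ h₁,
      (f₁ : S → ℝ) = (f₂ : S → ℝ) ∧ ‖f₁‖ ≤ C * ‖f₂‖) (X : Finset S) (α : X → ℝ) :
    ‖kernelCombination k₂ h₂ X α‖ ≤ C * ‖kernelCombination k₁ h₁ X α‖ := by
  obtain ⟨f, hf, hn⟩ := h (kernelCombination k₂ h₂ X α)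
  set u := kernelCombination k₂ h₂ X α with hu
  set w := kernelCombination k₁ h₁ X α with hw
  have key : ‖u‖ * ‖u‖ ≤ (C * ‖w‖) * ‖u‖ := calc
    ‖u‖ * ‖u‖ = inner ℝ u u := (real_inner_self_eq_norm_mul_norm u).symm
    _ = inner ℝ w f := by
      rw [hw, inner_kernelCombination k₁ h₁, hf, ← inner_kernelCombination k₂ h₂]
    _ ≤ ‖w‖ * ‖f‖ := real_inner_le_norm _ _
    _ ≤ ‖w‖ * (C * ‖u‖) := by gcongr
    _ = (C * ‖w‖) * ‖u‖ := by ring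
  rcases (norm_nonneg u).eq_or_lt with h0 | h0
  · rw [← h0]; positivity
  · exact le_of_mul_le_mul_right key h0

theorem NormEquivalentKernels.kernelForm_le {S : Type*} {k₁ k₂ : S → S → ℝ} {C : ℝ}
    (h : NormEquivalentKernels k₁ k₂ C) (X : Finset S) (α : X → ℝ) :
    kernelForm k₂ X α ≤ C ^ 2 * kernelForm k₁ X α ∧
      kernelForm k₁ X α ≤ C ^ 2 * kernelForm k₂ X α := by
  obtain ⟨hC, h₁, h₂, hr, hn⟩ := h
  rw [kernelForm_eq_norm_sq k₁ h₁, kernelForm_eq_norm_sq k₂ h₂, ← mul_pow, ← mul_pow]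
  constructor
  · refine pow_le_pow_left₀ (norm_nonneg _)
      (norm_kernelCombination_le h₁ h₂ hC.le (fun f₂ => ?_) X α) 2
    obtain ⟨f₁, hf⟩ : (f₂ : S → ℝ) ∈ Set.range fun f : KernelSpace k₁ h₁ => (f : S → ℝ) :=
      hr ▸ Set.mem_range_self f₂
    exact ⟨f₁, hf, (inv_mul_le_iff₀ hC).1 (hn f₁ f₂ hf).1⟩
  · refine pow_le_pow_left₀ (norm_nonneg _)
      (norm_kernelCombination_le h₂ h₁ hC.le (fun f₁ => ?_) X α) 2
    obtain ⟨f₂, hf⟩ : (f₁ : S → ℝ) ∈ Set.range fun f : KernelSpace k₂ h₂ => (f : S → ℝ) :=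
      hr ▸ Set.mem_range_self f₁
    exact ⟨f₂, hf, (hn f₁ f₂ hf.symm).2⟩

/-! ### Cosine transforms -/

section CosTransform

variable {V : Type*} [NormedAddCommGroup V] [InnerProductSpace ℝ V] [MeasurableSpace V]
  [BorelSpace V] [FiniteDimensional ℝ V]

/-- The cosine transform `∫ F(v) cos(2π ⟨v, x⟩) dv`. -/
noncomputable def cosTransform (F : V → ℝ) (x : V) : ℝ :=
  ∫ v, F v * Real.cos (2 * Real.pi * inner ℝ v x)

theorem MeasureTheory.Integrable.mul_cos_inner {F : V → ℝ} (hF : Integrable F) (x : V) :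
    Integrable fun v => F v * Real.cos (2 * Real.pi * inner ℝ v x) := by
  refine hF.mul_bdd (c := 1) (Continuous.aestronglyMeasurable (by fun_prop)) ?_
  filter_upwards with v
  simpa using Real.abs_cos_le_one _

theorem cosTransform_zero_right (F : V → ℝ) : cosTransform F 0 = ∫ v, F v := by
  simp [cosTransform]

theorem cosTransform_neg_right (F : V → ℝ) (x : V) :
    cosTransform F (-x) = cosTransform F x := by
  simp [cosTransform]

theorem cosTransform_add {F G : V → ℝ} (hF : Integrable F) (hG : Integrable G) (x : V) :
    cosTransform (fun v => F v + G v) x = cosTransform F x + cosTransform G x := by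
  simp only [cosTransform, add_mul]
  exact integral_add (hF.mul_cos_inner x) (hG.mul_cos_inner x)

theorem cosTransform_sub {F G : V → ℝ} (hF : Integrable F) (hG : Integrable G) (x : V) :
    cosTransform (fun v => F v - G v) x = cosTransform F x - cosTransform G x := by
  simp only [cosTransform, sub_mul]
  exact integral_sub (hF.mul_cos_inner x) (hG.mul_cos_inner x)

theorem cosTransform_const_mul (c : ℝ) (F : V → ℝ) (x : V) :
    cosTransform (fun v => c * F v) x = c * cosTransform F x := by
  simp only [cosTransform, mul_assoc]
  exact integral_const_mul _ _

theorem cosTransform_comp_smul (F : V → ℝ) {q : ℝ} (hq : q ≠ 0) (x : V) :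
    cosTransform (fun v => F (q • v)) x
      = |(q ^ Module.finrank ℝ V)⁻¹| * cosTransform F (q⁻¹ • x) := by
  have h := Measure.integral_comp_smul (volume : Measure V)
    (fun v => F v * Real.cos (2 * Real.pi * inner ℝ v (q⁻¹ • x))) q
  refine Eq.trans ?_ h
  refine integral_congr_ae (Filter.Eventually.of_forall fun v => ?_)
  simp only [inner_smul_left, inner_smul_right, conj_trivial]
  rw [inv_mul_cancel_left₀ hq]

theorem cosTransform_eq_re_fourier {F : V → ℝ} (hF : Integrable F) (x : V) :
    cosTransform F x = (FourierTransform.fourier (fun v => (F v : ℂ)) x).re := by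
  rw [Real.fourier_eq', cosTransform]
  have hi : Integrable fun v : V =>
      Complex.exp (((-2 * Real.pi * inner ℝ v x : ℝ) : ℂ) * Complex.I) • (F v : ℂ) := by
    refine hF.ofReal.bdd_mul (c := 1) (Continuous.aestronglyMeasurable (by fun_prop)) ?_
    filter_upwards with v
    rw [Complex.norm_exp_ofReal_mul_I]
  refine Eq.trans ?_ (integral_re hi)
  refine integral_congr_ae (Filter.Eventually.of_forall fun v => ?_)
  simp only [smul_eq_mul, RCLike.re_to_complex, Complex.re_mul_ofReal,
    Complex.exp_ofReal_mul_I_re]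
  rw [neg_mul, neg_mul, Real.cos_neg, mul_comm]

/-- Cosine transforms of nonnegative functions are positive semidefinite. -/
theorem sum_sum_cosTransform_nonneg {F : V → ℝ} (hF : Integrable F) (h0 : ∀ v, 0 ≤ F v)
    {ι : Type*} [Fintype ι] (α : ι → ℝ) (p : ι → V) :
    0 ≤ ∑ i, ∑ j, α i * α j * cosTransform F (p i - p j) := by
  have e : ∑ i, ∑ j, α i * α j * cosTransform F (p i - p j)
      = ∫ v, ∑ i, ∑ j,
        α i * α j * (F v * Real.cos (2 * Real.pi * inner ℝ v (p i - p j))) := by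
    rw [integral_finsetSum _ fun i _ => integrable_finsetSum _ fun j _ =>
      (hF.mul_cos_inner _).const_mul _]
    refine Finset.sum_congr rfl fun i _ => ?_
    rw [integral_finsetSum _ fun j _ => (hF.mul_cos_inner _).const_mul _]
    exact Finset.sum_congr rfl fun j _ => (integral_const_mul _ _).symm
  rw [e]
  refine integral_nonneg fun v => ?_
  set θ : ι → ℝ := fun i => 2 * Real.pi * inner ℝ v (p i)
  -- The real form of `|∑ α i e^{iθ i}|²`, by the addition formula for the cosine.
  have e2 : ∑ i, ∑ j, α i * α j * (F v * Real.cos (2 * Real.pi * inner ℝ v (p i - p j)))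
      = F v * ((∑ i, α i * Real.cos (θ i)) ^ 2 + (∑ i, α i * Real.sin (θ i)) ^ 2) := by
    rw [sq, sq, Finset.sum_mul_sum, Finset.sum_mul_sum]
    simp only [← Finset.sum_add_distrib, Finset.mul_sum]
    refine Finset.sum_congr rfl fun i _ => Finset.sum_congr rfl fun j _ => ?_
    rw [inner_sub_right, mul_sub, Real.cos_sub]
    ring
  simp only [Pi.zero_apply, e2]
  have := h0 v
  positivity

end CosTransform

/-! ### Bessel weights and Fourier inversion -/

section BesselWeight

variable {V : Type*} [NormedAddCommGroup V] [InnerProductSpace ℝ V]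

/-- The Fourier multiplier `(1 + ‖2π v‖²)^(-s)`. -/
noncomputable def besselWeight (s : ℝ) (v : V) : ℝ :=
  (1 + ‖(2 * Real.pi) • v‖ ^ 2) ^ (-s)

theorem besselWeight_pos (s : ℝ) (v : V) : 0 < besselWeight s v := by
  unfold besselWeight; positivity

theorem continuous_besselWeight (s : ℝ) : Continuous (besselWeight s : V → ℝ) := by
  refine Continuous.rpow_const (by fun_prop) fun v => Or.inl ?_
  positivity

theorem besselWeight_anti {s t : ℝ} (h : s ≤ t) (v : V) : besselWeight t v ≤ besselWeight s v := by
  refine Real.rpow_le_rpow_of_exponent_le ?_ (by linarith)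
  nlinarith [sq_nonneg ‖(2 * Real.pi) • v‖]

/-- Peetre's inequality. -/
theorem besselWeight_mul_le {s : ℝ} (hs : 0 ≤ s) (v w : V) :
    2 ^ (-s) * (besselWeight s v * besselWeight s w) ≤ besselWeight s (v - w) := by
  unfold besselWeight
  rw [← Real.mul_rpow (by positivity) (by positivity),
    ← Real.mul_rpow (by positivity) (by positivity)]
  refine Real.rpow_le_rpow_of_nonpos (by positivity) ?_ (by linarith)
  rw [smul_sub]
  set a := (2 * Real.pi) • v
  set b := (2 * Real.pi) • w
  nlinarith [norm_sub_le a b, norm_nonneg (a - b), sq_nonneg (‖a‖ - ‖b‖), norm_nonneg a,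
    norm_nonneg b, sq_nonneg (‖a‖ * ‖b‖)]

variable [MeasurableSpace V] [BorelSpace V] [FiniteDimensional ℝ V]

theorem integrable_besselWeight {s : ℝ} (hs : (Module.finrank ℝ V : ℝ) / 2 < s) :
    Integrable (besselWeight s : V → ℝ) := by
  have h := (integrable_rpow_neg_one_add_norm_sq (E := V) (μ := volume) (r := 2 * s)
    (by linarith)).comp_smul (R := 2 * Real.pi) (by positivity)
  refine h.congr (Filter.Eventually.of_forall fun v => ?_)
  simp only [besselWeight]
  congr 1
  ring

end BesselWeight

/-- Fourier inversion, available because `s > d/2` makes the weight integrable. The `2π` in the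
weight and the prefactor convert the unitary normalization to the one with `e^{-2πi⟨v,x⟩}`. -/
theorem HasSobolevDecay.eq_cosTransform {d : ℕ} {Φ : EuclideanSpace ℝ (Fin d) → ℝ} {s : ℝ}
    (h : HasSobolevDecay Φ s) (hs : (d : ℝ) / 2 < s) (x : EuclideanSpace ℝ (Fin d)) :
    Φ x = (2 * Real.pi) ^ ((d : ℝ) / 2) * cosTransform (besselWeight s) x := by
  set A : ℝ := (2 * Real.pi) ^ ((d : ℝ) / 2)
  have hint : Integrable (besselWeight s : EuclideanSpace ℝ (Fin d) → ℝ) :=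
    integrable_besselWeight (by simpa using hs)
  have hF : FourierTransform.fourier (fun x => (Φ x : ℂ))
      = fun v => ((A * besselWeight s v : ℝ) : ℂ) := by
    funext v
    have h1 := h.fourier_eq ((2 * Real.pi) • v)
    have h2 : (A : ℂ) * (((2 * Real.pi) ^ (-(d : ℝ) / 2) : ℝ) : ℂ) = 1 := by
      rw [← Complex.ofReal_mul, ← Real.rpow_add (by positivity)]
      simp [neg_div]
    rw [unitaryFourier] at h1
    rw [Real.fourier_eq', Complex.ofReal_mul, besselWeight, ← h1, ← mul_assoc, h2, one_mul]
    refine integral_congr_ae (Filter.Eventually.of_forall fun y => ?_)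
    simp only [smul_eq_mul, inner_smul_left, conj_trivial]
    rw [mul_comm, real_inner_comm]
    congr 2
    push_cast
    ring
  have hinv := (Complex.continuous_ofReal.comp h.continuous).fourierInv_fourier_eq h.integrable.ofReal (by
    change Integrable (FourierTransform.fourier fun x => (Φ x : ℂ))
    rw [hF]
    exact (hint.const_mul A).ofReal)
  have hx : FourierTransformInv.fourierInv (FourierTransform.fourier fun x => (Φ x : ℂ)) x = Φ x :=
    congrFun hinv x
  rw [Real.fourierInv_eq_fourier_neg, hF] at hx
  have := cosTransform_eq_re_fourier (hint.const_mul A) (-x)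
  rw [hx, cosTransform_neg_right, cosTransform_const_mul] at this
  simpa using this.symm

/-! ### Nonnegative bandlimited functions -/

section Bandlimited

open scoped SchwartzMap FourierTransform

theorem SchwartzMap.exists_norm_sq_le_besselWeight {V : Type*} [NormedAddCommGroup V]
    [InnerProductSpace ℝ V] (h : 𝓢(V, ℂ)) {τ : ℝ} (hτ : 0 ≤ τ) :
    ∃ K : ℝ, 0 ≤ K ∧ ∀ v, ‖h v‖ ^ 2 ≤ K * besselWeight τ v := by
  obtain ⟨k, hk⟩ := exists_nat_ge τ
  set B : ℝ := 2 ^ k * ((Finset.Iic (k, 0)).sup fun m => SchwartzMap.seminorm ℝ m.1 m.2) h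
  have hB : ∀ v, (1 + ‖v‖) ^ k * ‖h v‖ ≤ B := fun v => by
    simpa using SchwartzMap.one_add_le_sup_seminorm_apply (𝕜 := ℝ) (m := (k, 0)) (k := k)
      (n := 0) le_rfl le_rfl h v
  have hB0 : 0 ≤ B := (by positivity : (0 : ℝ) ≤ (1 + ‖(0 : V)‖) ^ k * ‖h 0‖).trans (hB 0)
  refine ⟨B ^ 2 * ((2 * Real.pi) ^ 2) ^ τ, by positivity, fun v => ?_⟩
  have h1 : (1 + ‖(2 * Real.pi) • v‖ ^ 2) ^ τ
      ≤ ((2 * Real.pi) ^ 2) ^ τ * ((1 + ‖v‖) ^ k) ^ 2 := by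
    have hp : 1 ≤ 2 * Real.pi := by linarith [Real.pi_gt_three]
    have hv : 1 ≤ 1 + ‖v‖ := by linarith [norm_nonneg v]
    calc (1 + ‖(2 * Real.pi) • v‖ ^ 2) ^ τ
        ≤ ((2 * Real.pi) ^ 2 * (1 + ‖v‖) ^ 2) ^ τ := by
          refine Real.rpow_le_rpow (by positivity) ?_ hτ
          rw [norm_smul, Real.norm_of_nonneg (by positivity)]
          nlinarith [norm_nonneg v, mul_nonneg (sq_nonneg (2 * Real.pi)) (norm_nonneg v)]
      _ = ((2 * Real.pi) ^ 2) ^ τ * ((1 + ‖v‖) ^ 2) ^ τ :=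
          Real.mul_rpow (by positivity) (by positivity)
      _ ≤ ((2 * Real.pi) ^ 2) ^ τ * ((1 + ‖v‖) ^ 2) ^ (k : ℝ) := by
          gcongr
          exact one_le_pow₀ hv
      _ = _ := by rw [Real.rpow_natCast, ← pow_mul, ← pow_mul, mul_comm 2 k]
  rw [besselWeight, Real.rpow_neg (by positivity), ← div_eq_mul_inv, le_div_iff₀ (by positivity)]
  calc ‖h v‖ ^ 2 * (1 + ‖(2 * Real.pi) • v‖ ^ 2) ^ τ
      ≤ ‖h v‖ ^ 2 * (((2 * Real.pi) ^ 2) ^ τ * ((1 + ‖v‖) ^ k) ^ 2) := by gcongr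
    _ = ((1 + ‖v‖) ^ k * ‖h v‖) ^ 2 * ((2 * Real.pi) ^ 2) ^ τ := by ring
    _ ≤ B ^ 2 * ((2 * Real.pi) ^ 2) ^ τ := by
      gcongr
      exact hB v

variable {V : Type*} [NormedAddCommGroup V] [InnerProductSpace ℝ V] [MeasurableSpace V]
  [BorelSpace V] [FiniteDimensional ℝ V]

/-- Plancherel for `b` and its translate by `x`, whose transform is that of `b` times a phase. The
right side is an autocorrelation, so it vanishes once the two supports are disjoint. -/
theorem SchwartzMap.fourier_norm_sq_fourier (b : 𝓢(V, ℂ)) (x : V) :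
    𝓕 (fun v => ((‖𝓕 b v‖ ^ 2 : ℝ) : ℂ)) x = ∫ y, inner ℂ (b y) (b (y - x)) := by
  have hs : ∀ v, 𝓕 (b.compSubConstCLM ℂ x) v
      = Complex.exp (((-2 * Real.pi * inner ℝ v x : ℝ) : ℂ) * Complex.I) * 𝓕 b v := by
    intro v
    rw [SchwartzMap.fourier_coe, SchwartzMap.fourier_coe]
    have := congrFun (VectorFourier.fourierIntegral_comp_add_right Real.fourierChar volume
      (innerₗ V) (b : V → ℂ) (-x)) v
    refine Eq.trans ?_ (this.trans ?_)
    · rw [Real.fourier_eq]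
      simp [VectorFourier.fourierIntegral, sub_eq_add_neg]
    · rw [Real.fourier_eq]
      simp only [VectorFourier.fourierIntegral, Circle.smul_def, Real.fourierChar_apply,
        innerₗ_apply_apply, inner_neg_left, real_inner_comm, smul_eq_mul]
      congr 3
      push_cast
      ring
  have hp := SchwartzMap.integral_inner_fourier_fourier b (b.compSubConstCLM ℂ x)
  simp only [SchwartzMap.compSubConstCLM_apply] at hp
  rw [← hp, Real.fourier_eq']
  refine integral_congr_ae (Filter.Eventually.of_forall fun v => ?_)
  simp only [hs v, smul_eq_mul, RCLike.inner_apply]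
  rw [mul_assoc (Complex.exp _), Complex.mul_conj, Complex.normSq_eq_norm_sq]

/-- A nonnegative function of rapid decay whose Fourier transform vanishes outside the unit
ball. -/
theorem exists_nonneg_bandlimited (V : Type*) [NormedAddCommGroup V] [InnerProductSpace ℝ V]
    [MeasurableSpace V] [BorelSpace V] [FiniteDimensional ℝ V] :
    ∃ g : V → ℝ, Continuous g ∧ Integrable g ∧ (∀ v, 0 ≤ g v) ∧ 0 < g 0 ∧
      (∀ τ : ℝ, 0 ≤ τ → ∃ K, 0 ≤ K ∧ ∀ v, g v ≤ K * besselWeight τ v) ∧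
      ∀ x, 1 ≤ ‖x‖ → 𝓕 (fun v => (g v : ℂ)) x = 0 := by
  -- Outer radius `1/2` separates the bump from its translates by vectors of norm at least `1`.
  let β : ContDiffBump (0 : V) := ⟨1 / 4, 1 / 2, by norm_num, by norm_num⟩
  have hcs : HasCompactSupport (fun v => (β v : ℂ)) :=
    β.hasCompactSupport.comp_left Complex.ofReal_zero
  have hsm : ContDiff ℝ ((⊤ : ℕ∞) : WithTop ℕ∞) (fun v => (β v : ℂ)) :=
    Complex.ofRealCLM.contDiff.comp β.contDiff
  let b : 𝓢(V, ℂ) := hcs.toSchwartzMap hsm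
  have hb : ∀ v, b v = β v := fun v => rfl
  have hcont : Continuous fun v => ‖𝓕 b v‖ ^ 2 := (𝓕 b).continuous.norm.pow 2
  have hdec : ∀ τ : ℝ, 0 ≤ τ → ∃ K, 0 ≤ K ∧ ∀ v, ‖𝓕 b v‖ ^ 2 ≤ K * besselWeight τ v :=
    fun τ hτ => (𝓕 b).exists_norm_sq_le_besselWeight hτ
  refine ⟨fun v => ‖𝓕 b v‖ ^ 2, hcont, ?_, fun v => by positivity, ?_, hdec, fun x hx => ?_⟩
  · obtain ⟨K, -, hK⟩ := hdec (Module.finrank ℝ V / 2 + 1) (by positivity)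
    refine ((integrable_besselWeight (V := V)
      (s := Module.finrank ℝ V / 2 + 1) (by linarith)).const_mul K).mono'
      hcont.aestronglyMeasurable (Filter.Eventually.of_forall fun v => ?_)
    rw [Real.norm_of_nonneg (by positivity)]
    exact hK v
  · have h0 : 𝓕 b 0 = ((∫ v, β v : ℝ) : ℂ) := by
      rw [SchwartzMap.fourier_coe, Real.fourier_eq', ← integral_complex_ofReal]
      simp [hb]
    have : 0 < ∫ v, β v := β.integral_pos
    simp only [h0, Complex.norm_real]
    exact pow_pos (norm_pos_iff.2 this.ne') 2
  · rw [SchwartzMap.fourier_norm_sq_fourier]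
    refine integral_eq_zero_of_ae (Filter.Eventually.of_forall fun y => ?_)
    simp only [hb, Pi.zero_apply]
    rcases le_or_gt (1 / 2) ‖y‖ with hy | hy
    · rw [β.zero_of_le_dist (x := y) (by simpa [β] using hy)]
      simp
    · have h1 : 1 / 2 ≤ ‖y - x‖ := by
        have := norm_sub_norm_le x y
        rw [norm_sub_rev] at this
        linarith
      rw [β.zero_of_le_dist (x := y - x) (by simpa [β] using h1)]
      simp

end Bandlimited

/-! ### The annihilated minorant -/

section Convolution

open scoped Convolution FourierTransform

variable {V : Type*} [NormedAddCommGroup V] [InnerProductSpace ℝ V] [MeasurableSpace V]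
  [BorelSpace V] [FiniteDimensional ℝ V]

theorem cosTransform_convolution_eq_zero {F G : V → ℝ} (hF : Integrable F) (hG : Integrable G)
    {x : V} (hx : 𝓕 (fun v => (F v : ℂ)) x = 0) :
    cosTransform (F ⋆[ContinuousLinearMap.mul ℝ ℝ] G) x = 0 := by
  have e : (fun v => (((F ⋆[ContinuousLinearMap.mul ℝ ℝ] G) v : ℝ) : ℂ))
      = (fun v => (F v : ℂ)) ⋆[ContinuousLinearMap.mul ℂ ℂ] fun v => (G v : ℂ) := by
    funext v
    simp only [convolution_def, ContinuousLinearMap.mul_apply']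
    rw [← integral_complex_ofReal]
    simp
  have hFc : Integrable fun v => (F v : ℂ) := hF.ofReal
  have hGc : Integrable fun v => (G v : ℂ) := hG.ofReal
  rw [cosTransform_eq_re_fourier (hF.integrable_convolution _ hG), e,
    Real.fourier_bilin_convolution_eq (ContinuousLinearMap.mul ℂ ℂ) hFc hGc, hx]
  simp

theorem besselWeight_le_one {V : Type*} [NormedAddCommGroup V] [InnerProductSpace ℝ V] {s : ℝ}
    (hs : 0 ≤ s) (v : V) : besselWeight s v ≤ 1 := by
  simpa [besselWeight] using besselWeight_anti hs v

/-- Peetre's inequality integrated against `g`: smoothing preserves the decay order from below. -/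
theorem mul_besselWeight_le_convolution {g : V → ℝ} (hg : Integrable g) (h0 : ∀ v, 0 ≤ g v)
    {s : ℝ} (hs : 0 ≤ s) (v : V) :
    2 ^ (-s) * (∫ w, g w * besselWeight s w) * besselWeight s v
      ≤ (g ⋆[ContinuousLinearMap.mul ℝ ℝ] besselWeight s) v := by
  have hi : ∀ φ : V → V, Continuous φ → Integrable fun w => g w * besselWeight s (φ w) := by
    intro φ hφ
    refine hg.mul_bdd (c := 1) ((continuous_besselWeight s).comp hφ).aestronglyMeasurable
      (Filter.Eventually.of_forall fun w => ?_)
    rw [Real.norm_of_nonneg (besselWeight_pos _ _).le]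
    exact besselWeight_le_one hs _
  simp only [convolution_def, ContinuousLinearMap.mul_apply']
  rw [mul_right_comm, ← integral_const_mul]
  refine integral_mono ((hi id continuous_id).const_mul _)
    (hi (fun w => v - w) (by fun_prop)) fun w => ?_
  calc 2 ^ (-s) * besselWeight s v * (g w * besselWeight s w)
      = g w * (2 ^ (-s) * (besselWeight s v * besselWeight s w)) := by ring
    _ ≤ g w * besselWeight s (v - w) :=
      mul_le_mul_of_nonneg_left (besselWeight_mul_le hs v w) (h0 w)

/-- A function whose cosine transform vanishes at the origin and outside the unit ball, bounded
below by a Bessel weight up to a Bessel weight of higher order. -/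
theorem exists_annihilated_minorant (V : Type*) [NormedAddCommGroup V] [InnerProductSpace ℝ V]
    [MeasurableSpace V] [BorelSpace V] [FiniteDimensional ℝ V] {s τ : ℝ}
    (hs : (Module.finrank ℝ V : ℝ) / 2 < s) (hτ : 0 ≤ τ) :
    ∃ ψ : V → ℝ, Integrable ψ ∧ (∀ x, x = 0 ∨ 1 ≤ ‖x‖ → cosTransform ψ x = 0) ∧
      ∃ a K : ℝ, 0 < a ∧ 0 ≤ K ∧
        ∀ v, a * besselWeight s v ≤ ψ v + K * besselWeight τ v := by
  have hs0 : 0 ≤ s := le_trans (by positivity) hs.le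
  obtain ⟨g, hgc, hgi, hg0, hgp, hgd, hgF⟩ := exists_nonneg_bandlimited V
  obtain ⟨K, hK, hgK⟩ := hgd τ hτ
  have hJ : Integrable (besselWeight s : V → ℝ) := integrable_besselWeight hs
  set κ := ∫ v : V, besselWeight s v with hκ
  have hκ0 : 0 ≤ κ := integral_nonneg fun v => (besselWeight_pos s v).le
  have hW := hgi.integrable_convolution (ContinuousLinearMap.mul ℝ ℝ) hJ
  -- Both terms have transforms divisible by that of `g`, hence zero outside the unit ball; `κ = ∫
  -- J_s` makes the total integral vanish. The subtracted `κ g` decays rapidly and is absorbed by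
  -- `J_τ`.
  refine ⟨fun v => (g ⋆[ContinuousLinearMap.mul ℝ ℝ] besselWeight s) v - κ * g v,
    hW.sub (hgi.const_mul κ), fun x hx => ?_, 2 ^ (-s) * ∫ w, g w * besselWeight s w, κ * K, ?_,
    by positivity, fun v => ?_⟩
  · rw [cosTransform_sub hW (hgi.const_mul κ), cosTransform_const_mul]
    rcases hx with rfl | hx
    · rw [cosTransform_zero_right, cosTransform_zero_right, integral_convolution _ hgi hJ]
      simp [hκ, mul_comm]
    · rw [cosTransform_convolution_eq_zero hgi hJ (hgF x hx), cosTransform_eq_re_fourier hgi,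
        hgF x hx]
      simp
  · refine mul_pos (by positivity) ?_
    refine integral_pos_of_integrable_nonneg_nonzero (x := 0)
      (hgc.mul (continuous_besselWeight s)) ?_
      (fun v => mul_nonneg (hg0 v) (besselWeight_pos s v).le)
      (mul_pos hgp (besselWeight_pos s 0)).ne'
    refine hgi.mul_bdd (c := 1) (continuous_besselWeight s).aestronglyMeasurable
      (Filter.Eventually.of_forall fun w => ?_)
    rw [Real.norm_of_nonneg (besselWeight_pos _ _).le]
    exact besselWeight_le_one hs0 _
  · have h1 := mul_besselWeight_le_convolution hgi hg0 hs0 v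
    have h2 := mul_le_mul_of_nonneg_left (hgK v) hκ0
    linarith

end Convolution

/-! ### Scaling and comparison on separated points -/

/-- Split at frequency `1/q`. If `q|t| ≤ 1`, then `1 + t² ≤ (D² + 1)/q²` and the first term
suffices; otherwise `1 + (qt)² ≤ 2q²(1 + t²)` and the second does. -/
theorem rpow_neg_le_of_scaled {s τ D q t : ℝ} (hs : 0 ≤ s) (hsτ : s ≤ τ) (hq : 0 < q)
    (hqD : q ≤ D) :
    (1 + t ^ 2) ^ (-s) ≤ (D ^ 2 + 1) ^ (τ - s) * q ^ (-(2 * (τ - s))) * (1 + t ^ 2) ^ (-τ)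
      + 2 ^ s * q ^ (2 * s) * (1 + (q * t) ^ 2) ^ (-s) := by
  have hD : 0 < D := hq.trans_le hqD
  have hq2 : ∀ r : ℝ, q ^ (2 * r) = (q ^ 2) ^ r := fun r => by
    rw [Real.rpow_mul hq.le, Real.rpow_two]
  rcases le_total ((q * t) ^ 2) 1 with h | h
  · refine le_add_of_le_of_nonneg ?_ (by positivity)
    calc (1 + t ^ 2) ^ (-s) = (1 + t ^ 2) ^ (τ - s) * (1 + t ^ 2) ^ (-τ) := by
          rw [← Real.rpow_add (by positivity)]
          congr 1
          ring
      _ ≤ ((D ^ 2 + 1) * (q ^ 2)⁻¹) ^ (τ - s) * (1 + t ^ 2) ^ (-τ) := by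
          refine mul_le_mul_of_nonneg_right
            (Real.rpow_le_rpow (by positivity) ?_ (by linarith)) (by positivity)
          rw [← div_eq_mul_inv, le_div_iff₀ (by positivity)]
          nlinarith
      _ = _ := by
          rw [Real.mul_rpow (by positivity) (by positivity), Real.inv_rpow (by positivity), ← hq2,
            ← Real.rpow_neg hq.le]
  · refine le_add_of_nonneg_of_le (by positivity) ?_
    rw [hq2, ← Real.mul_rpow (by positivity) (by positivity)]
    rw [Real.rpow_neg (by positivity), Real.rpow_neg (by positivity), ← div_eq_mul_inv,
      ← Real.div_rpow (by positivity) (by positivity), ← Real.inv_rpow (by positivity)]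
    refine Real.rpow_le_rpow (by positivity) ?_ hs
    rw [inv_le_comm₀ (by positivity) (by positivity), inv_div, div_le_iff₀ (by positivity)]
    nlinarith

theorem scaled_rpow_neg_le {τ D q t : ℝ} (hτ : 0 ≤ τ) (hD : 1 ≤ D) (hq : 0 < q) (hqD : q ≤ D) :
    (1 + (q * t) ^ 2) ^ (-τ) ≤ D ^ (2 * τ) * q ^ (-(2 * τ)) * (1 + t ^ 2) ^ (-τ) := by
  have hD0 : 0 < D := hq.trans_le hqD
  have e : D ^ (2 * τ) * q ^ (-(2 * τ)) * (1 + t ^ 2) ^ (-τ)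
      = ((q / D) ^ 2 * (1 + t ^ 2)) ^ (-τ) := by
    rw [Real.mul_rpow (by positivity) (by positivity), ← Real.rpow_two (q / D),
      ← Real.rpow_mul (by positivity), Real.div_rpow hq.le hD0.le, mul_neg, Real.rpow_neg hD0.le]
    field_simp
  rw [e]
  refine Real.rpow_le_rpow_of_nonpos (by positivity) ?_ (by linarith)
  have h1 : (q / D) ^ 2 ≤ 1 := pow_le_one₀ (by positivity) ((div_le_one hD0).2 hqD)
  have h2 : (q / D) ^ 2 ≤ q ^ 2 := by
    gcongr
    exact div_le_self hq.le hD
  nlinarith [mul_le_mul_of_nonneg_right h2 (sq_nonneg t)]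

/-- Comparison of quadratic forms of Bessel kernels on separated points. -/
theorem exists_sum_cosTransform_besselWeight_le (V : Type*) [NormedAddCommGroup V]
    [InnerProductSpace ℝ V] [MeasurableSpace V] [BorelSpace V] [FiniteDimensional ℝ V]
    {s τ D : ℝ} (hs : (Module.finrank ℝ V : ℝ) / 2 < s) (hsτ : s ≤ τ) (hD : 1 ≤ D) :
    ∃ c : ℝ, 0 < c ∧ ∀ q : ℝ, 0 < q → q ≤ D → ∀ {ι : Type} [Fintype ι] (α : ι → ℝ) (p : ι → V),
      (∀ i j, i ≠ j → q ≤ dist (p i) (p j)) →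
      ∑ i, ∑ j, α i * α j * cosTransform (besselWeight s) (p i - p j)
        ≤ c * q ^ (-(2 * (τ - s))) *
          ∑ i, ∑ j, α i * α j * cosTransform (besselWeight τ) (p i - p j) := by
  have hs0 : 0 ≤ s := le_trans (by positivity) hs.le
  have hτ0 : 0 ≤ τ := hs0.trans hsτ
  obtain ⟨ψ, hψi, hψ0, a, K, ha, hK, hψ⟩ := exists_annihilated_minorant V hs hτ0
  -- The first summand pays for low frequencies, the second for the error `K J_τ(q v)` of the
  -- minorant after rescaling.
  set c : ℝ := (D ^ 2 + 1) ^ (τ - s) + 2 ^ s * (a⁻¹ * (K * D ^ (2 * τ))) with hc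
  refine ⟨c, by positivity, fun q hq hqD ι _ α p hp => ?_⟩
  set M : ℝ := c * q ^ (-(2 * (τ - s)))
  set l : ℝ := 2 ^ s * q ^ (2 * s) * a⁻¹ with hl
  have hJs : Integrable (besselWeight s : V → ℝ) := integrable_besselWeight hs
  have hJτ : Integrable (besselWeight τ : V → ℝ) := integrable_besselWeight (hs.trans_le hsτ)
  have hψq : Integrable fun v => ψ (q • v) := hψi.comp_smul hq.ne'
  have hMl : Integrable fun v => M * besselWeight τ v + l * ψ (q • v) :=
    (hJτ.const_mul M).add (hψq.const_mul l)
  have hpt : ∀ v : V, besselWeight s v ≤ M * besselWeight τ v + l * ψ (q • v) := by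
    intro v
    have hn : ‖(2 * Real.pi) • (q • v)‖ = q * ‖(2 * Real.pi) • v‖ := by
      rw [smul_comm, norm_smul, Real.norm_of_nonneg hq.le]
    have h1 := hψ (q • v)
    simp only [besselWeight, hn] at h1 ⊢
    set t := ‖(2 * Real.pi) • v‖
    have h2 := rpow_neg_le_of_scaled (t := t) hs0 hsτ hq hqD
    have h3 := scaled_rpow_neg_le (t := t) hτ0 hD hq hqD
    have h4 : (1 + (q * t) ^ 2) ^ (-s) ≤ a⁻¹ * (ψ (q • v)
        + K * (D ^ (2 * τ) * q ^ (-(2 * τ)) * (1 + t ^ 2) ^ (-τ))) := by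
      rw [le_inv_mul_iff₀ ha]
      exact h1.trans (by gcongr)
    have h5 := h2.trans (add_le_add_right (mul_le_mul_of_nonneg_left h4
      (by positivity : 0 ≤ 2 ^ s * q ^ (2 * s))) _)
    have h6 : q ^ (2 * s) * q ^ (-(2 * τ)) = q ^ (-(2 * (τ - s))) := by
      rw [← Real.rpow_add hq]
      congr 1
      ring
    refine h5.trans_eq ?_
    simp only [M, hc, hl, ← h6]
    ring
  have hF0 := sum_sum_cosTransform_nonneg
    (F := fun v => M * besselWeight τ v + l * ψ (q • v) - besselWeight s v)
    (hMl.sub hJs) (fun v => sub_nonneg.2 (hpt v)) α p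
  have hcos : ∀ i j, cosTransform
      (fun v => M * besselWeight τ v + l * ψ (q • v) - besselWeight s v) (p i - p j)
      = M * cosTransform (besselWeight τ) (p i - p j)
        - cosTransform (besselWeight s) (p i - p j) := by
    intro i j
    -- The diagonal uses the vanishing at the origin, the other entries the separation.
    have hz : cosTransform ψ (q⁻¹ • (p i - p j)) = 0 := by
      refine hψ0 _ ?_
      by_cases hij : i = j
      · simp [hij]
      · right
        rw [norm_smul, Real.norm_of_nonneg (by positivity), ← dist_eq_norm,
          le_inv_mul_iff₀ hq, mul_one]
        exact hp i j hij
    rw [cosTransform_sub hMl hJs,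
      cosTransform_add (hJτ.const_mul M) (hψq.const_mul l), cosTransform_const_mul,
      cosTransform_const_mul, cosTransform_comp_smul ψ hq.ne', hz]
    ring
  simp only [hcos, mul_sub, Finset.sum_sub_distrib, mul_left_comm _ M, ← Finset.mul_sum] at hF0
  linarith

/-! ### Application to the kernel matrices -/

theorem HasSobolevDecay.kernelForm_eq {d : ℕ} {Ω : Set (EuclideanSpace ℝ (Fin d))}
    {Φ : EuclideanSpace ℝ (Fin d) → ℝ} {s : ℝ} (h : HasSobolevDecay Φ s) (hs : (d : ℝ) / 2 < s)
    (X : Finset Ω) (α : X → ℝ) :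
    kernelForm (translationKernel Ω Φ) X α = (2 * Real.pi) ^ ((d : ℝ) / 2) *
      ∑ x : X, ∑ y : X, α x * α y * cosTransform (besselWeight s)
        (((x : Ω) : EuclideanSpace ℝ (Fin d)) - ((y : Ω) : EuclideanSpace ℝ (Fin d))) := by
  simp only [kernelForm, translationKernel, h.eq_cosTransform hs, Finset.mul_sum]
  refine Finset.sum_congr rfl fun x _ => Finset.sum_congr rfl fun y _ => ?_
  ring

theorem sum_cosTransform_besselWeight_mono {V : Type*} [NormedAddCommGroup V]
    [InnerProductSpace ℝ V] [MeasurableSpace V] [BorelSpace V] [FiniteDimensional ℝ V]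
    {s τ : ℝ} (hs : (Module.finrank ℝ V : ℝ) / 2 < s) (hsτ : s ≤ τ) {ι : Type*} [Fintype ι]
    (α : ι → ℝ) (p : ι → V) :
    ∑ i, ∑ j, α i * α j * cosTransform (besselWeight τ) (p i - p j)
      ≤ ∑ i, ∑ j, α i * α j * cosTransform (besselWeight s) (p i - p j) := by
  have hJs : Integrable (besselWeight s : V → ℝ) := integrable_besselWeight hs
  have hJτ : Integrable (besselWeight τ : V → ℝ) := integrable_besselWeight (hs.trans_le hsτ)
  have h := sum_sum_cosTransform_nonneg (hJs.sub hJτ)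
    (fun v => sub_nonneg.2 (besselWeight_anti hsτ v)) α p
  have e : ∀ i j, cosTransform ((besselWeight s : V → ℝ) - besselWeight τ) (p i - p j)
      = cosTransform (besselWeight s) (p i - p j) - cosTransform (besselWeight τ) (p i - p j) :=
    fun i j => cosTransform_sub hJs hJτ _
  simp only [e, mul_sub, Finset.sum_sub_distrib] at h
  linarith

theorem mainTheorem5 (d : ℕ) (Ω : Set (EuclideanSpace ℝ (Fin d))) (hΩ : Bornology.IsBounded Ω)
    (τ σ : ℝ) (hτ : (d : ℝ) / 2 < τ) (hσ : (d : ℝ) / (2 * τ) < σ) (hσ1 : σ ≤ 1) :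
    ∃ c : ℝ, 0 < c ∧
      ∀ Φ Φσ : EuclideanSpace ℝ (Fin d) → ℝ,
        HasSobolevDecay Φ τ → HasSobolevDecay Φσ (σ * τ) →
      ∀ (k' kσ' : Ω → Ω → ℝ) (C C₁ : ℝ),
        NormEquivalentKernels (translationKernel Ω Φ) k' C →
        NormEquivalentKernels (translationKernel Ω Φσ) kσ' C₁ →
      ∀ X : Finset Ω, 2 ≤ X.card →
      ∀ α : EuclideanSpace ℝ X, α ≠ 0 →
        C₁ ^ (-2 : ℤ) * C ^ (-2 : ℤ) * rayleigh (kernelMatrix k' X) α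
            ≤ rayleigh (kernelMatrix kσ' X) α ∧
          rayleigh (kernelMatrix kσ' X) α
            ≤ C₁ ^ 2 * C ^ 2 * (c * separationDist X ^ (-((1 - σ) * (2 * τ)))) *
                rayleigh (kernelMatrix k' X) α := by
  have hd : (0 : ℝ) ≤ (d : ℝ) / 2 := by positivity
  have hτ0 : 0 < τ := hd.trans_lt hτ
  have hs : (d : ℝ) / 2 < σ * τ := by
    rw [div_lt_iff₀ (by positivity)] at hσ
    linarith
  have hsτ : σ * τ ≤ τ := by nlinarith
  have hfin : (Module.finrank ℝ (EuclideanSpace ℝ (Fin d)) : ℝ) / 2 < σ * τ := by simpa using hs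
  -- Boundedness of `Ω` enters only here: its diameter bounds every separation distance, so `c` is
  -- uniform in `X`.
  obtain ⟨c, hc, hcomp⟩ := exists_sum_cosTransform_besselWeight_le (EuclideanSpace ℝ (Fin d))
    (D := max 1 (Metric.diam Ω)) hfin hsτ (le_max_left _ _)
  refine ⟨c, hc, fun Φ Φσ hΦ hΦσ k' kσ' C C₁ hk hkσ X hX α _ => ?_⟩
  have hC := hk.1
  have hC₁ := hkσ.1
  obtain ⟨h1, h2⟩ := hk.kernelForm_le X α.ofLp
  obtain ⟨h3, h4⟩ := hkσ.kernelForm_le X α.ofLp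
  have hA : (0 : ℝ) ≤ (2 * Real.pi) ^ ((d : ℝ) / 2) := by positivity
  have hmono : kernelForm (translationKernel Ω Φ) X α.ofLp
      ≤ kernelForm (translationKernel Ω Φσ) X α.ofLp := by
    rw [hΦ.kernelForm_eq hτ, hΦσ.kernelForm_eq hs]
    exact mul_le_mul_of_nonneg_left (sum_cosTransform_besselWeight_mono hfin hsτ α.ofLp
      fun x : X => ((x : Ω) : EuclideanSpace ℝ (Fin d))) hA
  have hnt : X.Nontrivial := Finset.one_lt_card_iff_nontrivial.1 (by omega)
  have hq0 : 0 < separationDist X := (Finset.infsep_pos_iff_nontrivial X).2 hnt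
  have hqD : separationDist X ≤ max 1 (Metric.diam Ω) := by
    obtain ⟨x, hx, y, hy, hxy⟩ := hnt
    refine le_max_of_le_right ((Set.infsep_le_dist_of_mem hx hy hxy).trans ?_)
    exact Metric.dist_le_diam_of_mem hΩ x.2 y.2
  have hsep : kernelForm (translationKernel Ω Φσ) X α.ofLp
      ≤ c * separationDist X ^ (-((1 - σ) * (2 * τ)))
        * kernelForm (translationKernel Ω Φ) X α.ofLp := by
    rw [hΦ.kernelForm_eq hτ, hΦσ.kernelForm_eq hs, mul_left_comm]
    refine mul_le_mul_of_nonneg_left ?_ hA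
    have := hcomp _ hq0 hqD α.ofLp (fun x : X => ((x : Ω) : EuclideanSpace ℝ (Fin d)))
      fun x y hxy => Set.infsep_le_dist_of_mem x.2 y.2 fun h => hxy (Subtype.ext h)
    rwa [show 2 * (τ - σ * τ) = (1 - σ) * (2 * τ) by ring] at this
  set E := c * separationDist X ^ (-((1 - σ) * (2 * τ)))
  have hE : 0 ≤ E := by positivity
  rw [rayleigh_kernelMatrix, rayleigh_kernelMatrix, ← mul_div_assoc, ← mul_div_assoc]
  constructor
  · gcongr
    rw [zpow_neg, zpow_neg, ← mul_inv, inv_mul_le_iff₀ (by positivity)]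
    norm_cast
    calc kernelForm k' X α.ofLp ≤ C ^ 2 * kernelForm (translationKernel Ω Φ) X α.ofLp := h1
      _ ≤ C ^ 2 * (C₁ ^ 2 * kernelForm kσ' X α.ofLp) := by
        gcongr
        exact hmono.trans h4
      _ = _ := by ring
  · gcongr
    calc kernelForm kσ' X α.ofLp
        ≤ C₁ ^ 2 * kernelForm (translationKernel Ω Φσ) X α.ofLp := h3
      _ ≤ C₁ ^ 2 * (E * (C ^ 2 * kernelForm k' X α.ofLp)) := by
        gcongr
        exact hsep.trans (mul_le_mul_of_nonneg_left h2 hE)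
      _ = _ := by ring
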